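/- Let $C, D_1,\dots,D_m\subseteq\mathbb{R}^n$ be nonempty closed sets, where each $D_i$ is convex ($C$ may be nonconvex). Write $d_D(x)$ for the Euclidean distance from $x$ to $D$, $P_D(x)$ for the set of projections of $x$ onto $D$, and $\delta_C$ for the indicator function of $C$ ($0$ on $C$, $+\infty$ elsewhere). For a nonempty closed set $A$ let $A^\infty=\{d:\exists\,a^t\in A,\ \lambda_t\downarrow 0\text{ with }\lambda_t a^t\to d\}$ be its horizon cone. Let $\psi:\mathbb{R}_+\to\mathbb{R}_+$ be continuous, concave and level-bounded, with $\psi(0)=0$, continuously differentiable on $(0,\infty)$ with positive derivative, such that $\lim_{s\downarrow0}\psi'(s)$ exists and is positive and the right derivative $\psi'_+$ is Lipschitz continuous on $\mathbb{R}_+$. Put $\Psi(x)=\sum_{i=1}^m\psi(d_{D_i}^2(x))$. For a proper $f:\mathbb{R}^n\to(-\infty,\infty]$ and $\bar x\in\operatorname{dom}f=\{f<\infty\}$, let $\widehat\partial f(\bar x)$ be the set of $v$ with $\liminf_{x\to\bar x,\,x\ne\bar x}\frac{f(x)-f(\bar x)-\langle v,x-\bar x\rangle}{\|x-\bar x\|}\ge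 0$, and let $\partial f(\bar x)$ be the set of limits of sequences $v^t\in\widehat\partial f(x^t)$ with $x^t\to\bar x$ and $f(x^t)\to f(\bar x)$; both sets are empty for $\bar x\notin\operatorname{dom}f$. Let $N_C(x)=\partial\delta_C(x)$. A proper lower semicontinuous function $f$ is a KL function if for every $\hat x$ with $\partial f(\hat x)\neq\emptyset$ there are a neighbourhood $\mathcal N$ of $\hat x$, $\nu\in(0,\infty]$ and a continuous concave $\phi:[0,\nu)\to\mathbb{R}_+$ with $\phi(0)=0$, continuously differentiable on $(0,\nu)$ with positive derivative, such that $\phi'(f(x)-f(\hat x))\,\operatorname{dist}(0,\partial f(x))\ge1$ whenever $x\in\mathcal N$ and $f(\hat x)<f(x)<f(\hat x)+\nu$ (with $\operatorname{dist}(0,\emptyset)=+\infty$). Consider the following subgradient projection algorithm with monotone linesearch. Choose $\alpha_{\max}>\alpha_{\min}>0$, $\eta\in(0,1)$, $\sigma>0$ and $x^0\in C$. For $t=0,1,2,\dots$: choose $\alpha_t^0\in[\alpha_{\min},\alpha_{\max}]$ and $\xi_i^t\in P_{D_i}(x^t)$ ($i=1,\dots,m$), and set $g^t=2\sum_{i=1}^m\psi'_+(d_{D_i}^2(x^t))(x^t-\xi_i^t)$.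 For $\alpha=\alpha_t^0,\ \eta\alpha_t^0,\ \eta^2\alpha_t^0,\dots$ in turn, choose any $$\tilde u\in\operatorname*{Argmin}_{u\in C}\Big\{\langle g^t,u-x^t\rangle+\tfrac1{2\alpha}\|u-x^t\|^2\Big\},$$ until $\Psi(\tilde u)-\Psi(x^t)\le-\frac\sigma2\|\tilde u-x^t\|^2$ holds; then set $x^{t+1}=\tilde u$ for the first such $\tilde u$. Theorem. Suppose that $C^\infty\cap\bigcap_{i=1}^mD_i^\infty=\{0\}$ and that $\Psi+\delta_C$ is a KL function. Then every sequence $\{x^t\}$ generated by this algorithm converges to a stationary point of $\Psi+\delta_C$, that is, to a point $\bar x$ satisfying $$0\in\sum_{i=1}^m 2\psi'_+(d_{D_i}^2(\bar x))\,(\bar x-P_{D_i}(\bar x))+N_C(\bar x).$$ -/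

import Mathlib

open Filter Topology Set
open scoped NNReal ENNReal RealInnerProductSpace

noncomputable section

namespace SubgradProj

section Variational

variable {E : Type*} [NormedAddCommGroup E] [InnerProductSpace ℝ E]

/-- The set `P_D(x)` of projections of `x` onto `D`. -/
def proj (D : Set E) (x : E) : Set E := {ξ | ξ ∈ D ∧ ‖x - ξ‖ = Metric.infDist x D}

/-- The horizon cone of `C`: limits of `λ_t x^t` with `x^t ∈ C`, `λ_t > 0`, `λ_t → 0`. -/
def horizonCone (C : Set E) : Set E :=
  {d | ∃ (x : ℕ → E) (lam : ℕ → ℝ), (∀ t, x t ∈ C) ∧ (∀ t, 0 < lam t) ∧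
    Tendsto lam atTop (𝓝 0) ∧ Tendsto (fun t => lam t • x t) atTop (𝓝 d)}

open Classical in
/-- The indicator function `δ_C`. -/
def indic (C : Set E) (x : E) : EReal := if x ∈ C then 0 else ⊤

/-- Regular (Fréchet) subgradients; empty outside `dom f`. -/
def regSubdiff (f : E → EReal) (xbar : E) : Set E :=
  {v | f xbar < ⊤ ∧
    0 ≤ liminf (fun x => (f x - f xbar - ((⟪v, x - xbar⟫ : ℝ) : EReal)) /
      ((‖x - xbar‖ : ℝ) : EReal)) (𝓝[≠] xbar)}

/-- Limiting subgradients; empty outside `dom f`. -/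
def subdiff (f : E → EReal) (xbar : E) : Set E :=
  {v | f xbar < ⊤ ∧ ∃ (x w : ℕ → E),
    Tendsto x atTop (𝓝 xbar) ∧ Tendsto (fun t => f (x t)) atTop (𝓝 (f xbar)) ∧
    (∀ t, w t ∈ regSubdiff f (x t)) ∧ Tendsto w atTop (𝓝 v)}

/-- The normal cone `N_C(x) = ∂δ_C(x)`; empty for `x ∉ C`. -/
def normalCone (C : Set E) (x : E) : Set E := subdiff (indic C) x

/-- `f` has nonempty domain and never takes the value `-∞`. -/
def Proper (f : E → EReal) : Prop := (∃ x, f x < ⊤) ∧ ∀ x, f x ≠ ⊥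

/-- The class `Ξ_ν` of desingularizing functions, `ν ∈ (0,∞]`; only the values of `φ` on
`[0,ν)` matter. -/
structure IsDesing (ν : EReal) (φ : ℝ → ℝ) : Prop where
  continuousOn : ContinuousOn φ {s : ℝ | 0 ≤ s ∧ (s : EReal) < ν}
  concaveOn : ConcaveOn ℝ {s : ℝ | 0 ≤ s ∧ (s : EReal) < ν} φ
  nonneg : ∀ s : ℝ, 0 ≤ s → (s : EReal) < ν → 0 ≤ φ s
  differentiableOn : DifferentiableOn ℝ φ {s : ℝ | 0 < s ∧ (s : EReal) < ν}
  continuousOn_deriv : ContinuousOn (deriv φ) {s : ℝ | 0 < s ∧ (s : EReal) < ν}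
  deriv_pos : ∀ s : ℝ, 0 < s → (s : EReal) < ν → 0 < deriv φ s
  map_zero : φ 0 = 0

/-- The Kurdyka-Łojasiewicz property of `f` at `xhat`. The distance is extended-valued, hence
`+∞` where the subdifferential is empty. -/
def KLAt (f : E → EReal) (xhat : E) : Prop :=
  ∃ N ∈ 𝓝 xhat, ∃ ν : EReal, 0 < ν ∧ ∃ φ : ℝ → ℝ, IsDesing ν φ ∧
    ∀ x ∈ N, f xhat < f x → f x < f xhat + ν →
      1 ≤ ENNReal.ofReal (deriv φ (f x - f xhat).toReal) * Metric.infEDist 0 (subdiff f x)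

/-- A proper closed function with the KL property at every point of `dom ∂f`. -/
structure IsKLFunction (f : E → EReal) : Prop where
  proper : Proper f
  closed : LowerSemicontinuous f
  kl : ∀ xhat, (subdiff f xhat).Nonempty → KLAt f xhat

end Variational

/-- The right derivative `ψ'_+`. -/
def rightDeriv (ψ : ℝ → ℝ) (s : ℝ) : ℝ := derivWithin ψ (Ici s) s

/-- The class `Θ`; only the values of `ψ` on `[0,∞)` matter. -/
structure IsTheta (ψ : ℝ → ℝ) : Prop where
  nonneg : ∀ s, 0 ≤ s → 0 ≤ ψ s
  levelBounded : ∀ c : ℝ, Bornology.IsBounded {s : ℝ | 0 ≤ s ∧ ψ s ≤ c}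
  continuousOn : ContinuousOn ψ (Ici 0)
  concaveOn : ConcaveOn ℝ (Ici 0) ψ
  differentiableOn : DifferentiableOn ℝ ψ (Ioi 0)
  continuousOn_deriv : ContinuousOn (deriv ψ) (Ioi 0)
  deriv_pos : ∀ s, 0 < s → 0 < deriv ψ s
  map_zero : ψ 0 = 0
  deriv_limit : ∃ l : ℝ, 0 < l ∧ Tendsto (deriv ψ) (𝓝[>] 0) (𝓝 l)
  lipschitz : ∃ L : ℝ≥0, LipschitzOnWith L (rightDeriv ψ) (Ici 0)

section Algorithm

variable {E : Type*} [NormedAddCommGroup E] [InnerProductSpace ℝ E] {m : ℕ}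

/-- `Ψ(x) = ∑ ψ(d_{D_i}(x)²)`. -/
def Psi (ψ : ℝ → ℝ) (D : Fin m → Set E) (x : E) : ℝ :=
  ∑ i, ψ (Metric.infDist x (D i) ^ 2)

/-- The extended-real-valued function `Ψ + δ_C`. -/
def objective (ψ : ℝ → ℝ) (D : Fin m → Set E) (C : Set E) (x : E) : EReal :=
  (Psi ψ D x : EReal) + indic C x

/-- The direction `2 ∑ ψ'_+(d_{D_i}(x)²) (x - ξ_i)`. -/
def direction (ψ : ℝ → ℝ) (D : Fin m → Set E) (x : E) (ξ : Fin m → E) : E :=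
  (2 : ℝ) • ∑ i, rightDeriv ψ (Metric.infDist x (D i) ^ 2) • (x - ξ i)

/-- `xbar` is a stationary point of `Ψ + δ_C`, that is,
`0 ∈ ∑ 2 ψ'_+(d_{D_i}(xbar)²) (xbar - P_{D_i}(xbar)) + N_C(xbar)`. -/
def IsStationary (ψ : ℝ → ℝ) (D : Fin m → Set E) (C : Set E) (xbar : E) : Prop :=
  ∃ ξ : Fin m → E, (∀ i, ξ i ∈ proj (D i) xbar) ∧
    ∃ v ∈ normalCone C xbar, direction ψ D xbar ξ + v = 0

/-- `u` minimizes `⟨g, u - x⟩ + ‖u - x‖² / (2α)` over `C`. -/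
def IsStep (C : Set E) (g x : E) (α : ℝ) (u : E) : Prop :=
  u ∈ C ∧ IsMinOn (fun w => ⟪g, w - x⟫ + 1 / (2 * α) * ‖w - x‖ ^ 2) C u

/-- The linesearch criterion at iteration `t` with memory `M` for the trial point `u`. -/
def Accepts (ψ : ℝ → ℝ) (D : Fin m → Set E) (σ : ℝ) (M : ℕ) (x : ℕ → E) (t : ℕ) (u : E) :
    Prop :=
  Psi ψ D u - (Finset.Icc (t - M) t).sup' (Finset.nonempty_Icc.2 (Nat.sub_le t M))
      (fun i => Psi ψ D (x i)) ≤ -(σ / 2) * ‖u - x t‖ ^ 2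

/-- A run of the subgradient projection algorithm with linesearch memory `M`. At iteration `t`
the trial points are `u t 0, …, u t (k t)`, with stepsizes `η ^ j * α₀ t`; the trial point
`u t (k t)` is the first accepted one and becomes `x (t + 1)`. -/
structure IsRun (ψ : ℝ → ℝ) (D : Fin m → Set E) (C : Set E) (M : ℕ)
    (αmin αmax η σ : ℝ) (α₀ : ℕ → ℝ) (ξ : ℕ → Fin m → E) (k : ℕ → ℕ) (u : ℕ → ℕ → E)
    (x : ℕ → E) : Prop where
  αmin_pos : 0 < αmin
  αmin_lt : αmin < αmax
  η_mem : η ∈ Ioo (0 : ℝ) 1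
  σ_pos : 0 < σ
  init : x 0 ∈ C
  α₀_mem : ∀ t, α₀ t ∈ Icc αmin αmax
  ξ_mem : ∀ t i, ξ t i ∈ proj (D i) (x t)
  trial : ∀ t, ∀ j ≤ k t, IsStep C (direction ψ D (x t) (ξ t)) (x t) (η ^ j * α₀ t) (u t j)
  rejected : ∀ t, ∀ j < k t, ¬ Accepts ψ D σ M x t (u t j)
  accepted : ∀ t, Accepts ψ D σ M x t (u t (k t))
  next : ∀ t, x (t + 1) = u t (k t)

/-- `x` is a sequence generated by the algorithm with linesearch memory `M`, for some admissible
parameters and choices. -/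
def IsGenerated (ψ : ℝ → ℝ) (D : Fin m → Set E) (C : Set E) (M : ℕ) (x : ℕ → E) : Prop :=
  ∃ (αmin αmax η σ : ℝ) (α₀ : ℕ → ℝ) (ξ : ℕ → Fin m → E) (k : ℕ → ℕ) (u : ℕ → ℕ → E),
    IsRun ψ D C M αmin αmax η σ α₀ ξ k u x

end Algorithm

end SubgradProj

end

/-!
Write `∇Ψ(x)` for `direction ψ D x ξ` with `ξ` the projections of `x`. The proof needs no calculus
of the distance function, only one inequality: as `ψ` is concave and `d(u) ≤ ‖u - ξ‖` for the
projection `ξ` of `x`,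
`Ψ(u) ≤ Ψ(x) + ⟪∇Ψ(x), u - x⟫ + m ψ'₊(0) ‖u - x‖²` (`Psi_le_quadratic`).

* The inequality makes every trial point with a small stepsize acceptable, so the accepted
  stepsizes are bounded away from zero (`IsRun.inv_stepsize_le`).
* Since `∇Ψ` is Lipschitz where the distances are bounded (`exists_lipschitz_direction`), the
  inequality with the two points exchanged also bounds `Ψ` from below near `x`, up to a quadratic
  error. Hence the sum of `∇Ψ(x)` and a proximal normal of `C` is a regular subgradient of `Ψ + δ_C`
  (`mem_regSubdiff_objective`).

Optimality of `x (t + 1)` in its subproblem gives such a proximal normal, and the resulting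
subgradient at `x (t + 1)` has norm at most a constant times `‖x (t + 1) - x t‖`. The values `Ψ(x t)`
decrease by at least `σ / 2 ‖x (t + 1) - x t‖²`, and the horizon condition makes the iterates bounded
(`isBounded_of_horizonCone`), so there is a cluster point, at which `0` is a limiting subgradient and
the Kurdyka-Łojasiewicz property is available. The potential
`‖x (t + 1) - x̄‖ + ‖x (t + 1) - x t‖ + c φ(Ψ(x (t + 1)) - Ψ(x̄))` is then nonincreasing near the cluster
point `x̄` and tends to `0` along a subsequence, hence tends to `0` (`tendsto_of_desing`). Stationarity
of the limit follows as the proximal normals converge to `-∇Ψ(x̄)`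
(`IsRun.isStationary_of_tendsto`).
-/

namespace SubgradProj

/-! ### Concave functions of one variable -/

/-- A concave function lies below its one-sided tangents. -/
theorem le_tangent_of_concaveOn {S : Set ℝ} {f : ℝ → ℝ} {a b p : ℝ} (hf : ConcaveOn ℝ S f)
    (ha : a ∈ S) (hb : b ∈ S) (hd : HasDerivWithinAt f p S a) :
    f b ≤ f a + p * (b - a) := by
  rcases lt_trichotomy a b with h | rfl | h
  · have h1 := hf.slope_le_of_hasDerivWithinAt ha hb h hd
    rw [slope_def_field, div_le_iff₀ (sub_pos.2 h)] at h1
    linarith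
  · simp
  · have h1 := hf.le_slope_of_hasDerivWithinAt hb ha h hd
    rw [slope_def_field, le_div_iff₀ (sub_pos.2 h)] at h1
    linarith

section Theta

variable {ψ : ℝ → ℝ}

theorem IsTheta.hasDerivWithinAt (hψ : IsTheta ψ) {s : ℝ} (hs : 0 ≤ s) :
    HasDerivWithinAt ψ (rightDeriv ψ s) (Ici 0) s := by
  rcases hs.eq_or_lt with rfl | hs
  · obtain ⟨l, -, hl⟩ := hψ.deriv_limit
    exact (hasDerivWithinAt_Ici_of_tendsto_deriv hψ.differentiableOn
      ((hψ.continuousOn 0 self_mem_Ici).mono Ioi_subset_Ici_self) self_mem_nhdsWithin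
      hl).differentiableWithinAt.hasDerivWithinAt
  · have h := (hψ.differentiableOn.differentiableAt (Ioi_mem_nhds hs)).hasDerivAt
    have h' : rightDeriv ψ s = deriv ψ s :=
      h.hasDerivWithinAt.derivWithin (uniqueDiffOn_Ici s s self_mem_Ici)
    rw [h']
    exact h.hasDerivWithinAt

theorem IsTheta.le_tangent (hψ : IsTheta ψ) {s r : ℝ} (hs : 0 ≤ s) (hr : 0 ≤ r) :
    ψ r ≤ ψ s + rightDeriv ψ s * (r - s) :=
  le_tangent_of_concaveOn hψ.concaveOn hs hr (hψ.hasDerivWithinAt hs)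

theorem IsTheta.rightDeriv_nonneg (hψ : IsTheta ψ) {s : ℝ} (hs : 0 ≤ s) :
    0 ≤ rightDeriv ψ s := by
  rcases hs.eq_or_lt with rfl | hs
  · have h1 := hψ.le_tangent le_rfl zero_le_one
    have h2 := hψ.nonneg 1 zero_le_one
    rw [hψ.map_zero] at h1
    linarith
  · have h := (hψ.differentiableOn.differentiableAt (Ioi_mem_nhds hs)).hasDerivAt
    have h' : rightDeriv ψ s = deriv ψ s :=
      h.hasDerivWithinAt.derivWithin (uniqueDiffOn_Ici s s self_mem_Ici)
    rw [h']
    exact (hψ.deriv_pos s hs).le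

theorem IsTheta.rightDeriv_le (hψ : IsTheta ψ) {s : ℝ} (hs : 0 ≤ s) :
    rightDeriv ψ s ≤ rightDeriv ψ 0 := by
  rcases hs.eq_or_lt with rfl | hs
  · exact le_rfl
  · have h1 := hψ.le_tangent le_rfl hs.le
    have h2 := hψ.le_tangent hs.le le_rfl
    nlinarith

end Theta

/-! ### Projections onto convex sets -/

theorem proj_nonempty {E : Type*} [NormedAddCommGroup E] [ProperSpace E] {D : Set E}
    (hcl : IsClosed D) (hne : D.Nonempty) (x : E) : (proj D x).Nonempty := by
  obtain ⟨ξ, hξ, h⟩ := hcl.exists_infDist_eq_dist hne x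
  exact ⟨ξ, hξ, by rw [h, dist_eq_norm]⟩

section Projection

variable {E : Type*} [NormedAddCommGroup E] [InnerProductSpace ℝ E]

theorem inner_le_zero_of_mem_proj {D : Set E} (hD : Convex ℝ D) {x ξ w : E} (hξ : ξ ∈ proj D x)
    (hw : w ∈ D) : ⟪x - ξ, w - ξ⟫ ≤ 0 := by
  refine (norm_eq_iInf_iff_real_inner_le_zero hD hξ.1).1 ?_ w hw
  rw [hξ.2, Metric.infDist_eq_iInf]
  simp_rw [dist_eq_norm]

/-- Projecting onto a convex set is nonexpansive. -/
theorem norm_proj_sub_proj_le {D : Set E} (hD : Convex ℝ D) {x y ξ ζ : E} (hξ : ξ ∈ proj D x)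
    (hζ : ζ ∈ proj D y) : ‖ξ - ζ‖ ≤ ‖x - y‖ := by
  have h1 := inner_le_zero_of_mem_proj hD hξ hζ.1
  have h2 := inner_le_zero_of_mem_proj hD hζ hξ.1
  have h3 : ⟪x - y, ξ - ζ⟫ = ‖ξ - ζ‖ ^ 2 - ⟪x - ξ, ζ - ξ⟫ - ⟪y - ζ, ξ - ζ⟫ := by
    rw [← real_inner_self_eq_norm_sq, ← neg_sub ξ ζ, inner_neg_right, sub_neg_eq_add,
      ← inner_add_left, ← inner_sub_left]
    congr 1
    abel
  have h4 := real_inner_le_norm (x - y) (ξ - ζ)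
  by_contra! h
  nlinarith [norm_nonneg (x - y), norm_nonneg (ξ - ζ)]

end Projection

/-! ### The penalty function and its gradient -/

theorem Psi_nonneg {E : Type*} [NormedAddCommGroup E] {m : ℕ} {ψ : ℝ → ℝ}
    {D : Fin m → Set E} (hψ : IsTheta ψ) (x : E) : 0 ≤ Psi ψ D x :=
  Finset.sum_nonneg fun _ _ => hψ.nonneg _ (sq_nonneg _)

theorem continuous_Psi {E : Type*} [NormedAddCommGroup E] {m : ℕ} {ψ : ℝ → ℝ}
    {D : Fin m → Set E} (hψ : IsTheta ψ) : Continuous (Psi ψ D) := by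
  refine continuous_finsetSum _ fun i _ => ?_
  exact hψ.continuousOn.comp_continuous ((Metric.continuous_infDist_pt (D i)).pow 2)
    fun x => mem_Ici.2 (sq_nonneg _)

section Penalty

variable {E : Type*} [NormedAddCommGroup E] [InnerProductSpace ℝ E] {m : ℕ} {ψ : ℝ → ℝ}
  {D : Fin m → Set E}

/-- The descent inequality. Concavity of `ψ` bounds `ψ (d(u)²)` by its tangent at `d(x)²`, and
`d(u) ≤ ‖u - ξ‖` for the projection `ξ` of `x`; neither convexity of the sets nor smoothness of
the distance is used. -/
theorem Psi_le_quadratic (hψ : IsTheta ψ) {x : E} {ξ : Fin m → E}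
    (hξ : ∀ i, ξ i ∈ proj (D i) x) (u : E) :
    Psi ψ D u ≤ Psi ψ D x + ⟪direction ψ D x ξ, u - x⟫ +
      m * rightDeriv ψ 0 * ‖u - x‖ ^ 2 := by
  have key : ∀ i, ψ (Metric.infDist u (D i) ^ 2) ≤ ψ (Metric.infDist x (D i) ^ 2) +
      2 * (rightDeriv ψ (Metric.infDist x (D i) ^ 2) * ⟪x - ξ i, u - x⟫) +
      rightDeriv ψ 0 * ‖u - x‖ ^ 2 := by
    intro i
    have h1 := hψ.le_tangent (sq_nonneg (Metric.infDist x (D i)))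
      (sq_nonneg (Metric.infDist u (D i)))
    have h2 : Metric.infDist u (D i) ^ 2 ≤ ‖u - ξ i‖ ^ 2 := by
      rw [← dist_eq_norm]
      exact pow_le_pow_left₀ Metric.infDist_nonneg (Metric.infDist_le_dist_of_mem (hξ i).1) 2
    have h3 : ‖u - ξ i‖ ^ 2 =
        Metric.infDist x (D i) ^ 2 + 2 * ⟪x - ξ i, u - x⟫ + ‖u - x‖ ^ 2 := by
      rw [← (hξ i).2, ← norm_add_sq_real]
      congr 2
      abel
    have h4 := hψ.rightDeriv_nonneg (sq_nonneg (Metric.infDist x (D i)))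
    have h5 := hψ.rightDeriv_le (sq_nonneg (Metric.infDist x (D i)))
    have h6 := mul_le_mul_of_nonneg_left (h2.trans_eq h3) h4
    have h7 := mul_le_mul_of_nonneg_right h5 (sq_nonneg ‖u - x‖)
    linarith
  have h := Finset.sum_le_sum fun i (_ : i ∈ Finset.univ) => key i
  rw [Finset.sum_add_distrib, Finset.sum_add_distrib, ← Finset.mul_sum] at h
  have hd : ⟪direction ψ D x ξ, u - x⟫ =
      2 * ∑ i, rightDeriv ψ (Metric.infDist x (D i) ^ 2) * ⟪x - ξ i, u - x⟫ := by
    simp only [direction, real_inner_smul_left, sum_inner]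
  rw [hd]
  simp only [Psi]
  simpa [mul_assoc] using h

/-- The gradient direction is Lipschitz where the distances to the sets stay bounded. -/
theorem exists_lipschitz_direction (hψ : IsTheta ψ) (hD : ∀ i, Convex ℝ (D i)) (B : ℝ) :
    ∃ L : ℝ, 0 ≤ L ∧ ∀ (x y : E) (ξ ζ : Fin m → E), (∀ i, Metric.infDist x (D i) ≤ B) →
      (∀ i, Metric.infDist y (D i) ≤ B) → (∀ i, ξ i ∈ proj (D i) x) →
      (∀ i, ζ i ∈ proj (D i) y) →
      ‖direction ψ D x ξ - direction ψ D y ζ‖ ≤ L * ‖x - y‖ := by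
  obtain ⟨K, hK⟩ := hψ.lipschitz
  have hp0 := hψ.rightDeriv_nonneg le_rfl
  refine ⟨2 * (m * (2 * K * B ^ 2 + 2 * rightDeriv ψ 0)), by positivity, ?_⟩
  intro x y ξ ζ hx hy hξ hζ
  have key : ∀ i, ‖rightDeriv ψ (Metric.infDist x (D i) ^ 2) • (x - ξ i) -
      rightDeriv ψ (Metric.infDist y (D i) ^ 2) • (y - ζ i)‖ ≤
      (2 * K * B ^ 2 + 2 * rightDeriv ψ 0) * ‖x - y‖ := by
    intro i
    set a := Metric.infDist x (D i) with ha
    set b := Metric.infDist y (D i) with hb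
    have ha0 : 0 ≤ a := Metric.infDist_nonneg
    have hb0 : 0 ≤ b := Metric.infDist_nonneg
    have haB : a ≤ B := hx i
    have hbB : b ≤ B := hy i
    have e : rightDeriv ψ (a ^ 2) • (x - ξ i) - rightDeriv ψ (b ^ 2) • (y - ζ i) =
        (rightDeriv ψ (a ^ 2) - rightDeriv ψ (b ^ 2)) • (x - ξ i) +
        rightDeriv ψ (b ^ 2) • ((x - y) - (ξ i - ζ i)) := by
      module
    have h1 : |rightDeriv ψ (a ^ 2) - rightDeriv ψ (b ^ 2)| ≤ K * |a ^ 2 - b ^ 2| := by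
      simpa [Real.dist_eq] using hK.dist_le_mul (a ^ 2) (sq_nonneg a) (b ^ 2) (sq_nonneg b)
    have h2 : |a - b| ≤ ‖x - y‖ := by
      have := (Metric.lipschitz_infDist_pt (D i)).dist_le_mul x y
      simpa [Real.dist_eq, dist_eq_norm, ← ha, ← hb] using this
    have h3 : |a ^ 2 - b ^ 2| ≤ 2 * B * ‖x - y‖ := by
      rw [sq_sub_sq, abs_mul, abs_of_nonneg (add_nonneg ha0 hb0)]
      exact mul_le_mul (by linarith) h2 (abs_nonneg _) (by linarith)
    have h4 : ‖(x - y) - (ξ i - ζ i)‖ ≤ 2 * ‖x - y‖ := by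
      have := norm_proj_sub_proj_le (hD i) (hξ i) (hζ i)
      linarith [norm_sub_le (x - y) (ξ i - ζ i)]
    have h5 : |rightDeriv ψ (a ^ 2) - rightDeriv ψ (b ^ 2)| ≤ K * (2 * B * ‖x - y‖) :=
      h1.trans (mul_le_mul_of_nonneg_left h3 K.2)
    have h6 : ‖x - ξ i‖ ≤ B := by rw [(hξ i).2]; exact haB
    have h7 := hψ.rightDeriv_nonneg (sq_nonneg b)
    have h8 := hψ.rightDeriv_le (sq_nonneg b)
    rw [e]
    refine (norm_add_le _ _).trans ?_
    rw [norm_smul, norm_smul, Real.norm_eq_abs, Real.norm_of_nonneg h7]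
    have h9 := mul_le_mul h5 h6 (norm_nonneg _) ((abs_nonneg _).trans h5)
    have h10 := mul_le_mul h8 h4 (norm_nonneg _) hp0
    refine (add_le_add h9 h10).trans_eq ?_
    ring
  have h := (norm_sum_le _ _).trans (Finset.sum_le_sum fun i (_ : i ∈ Finset.univ) => key i)
  rw [direction, direction, ← smul_sub, ← Finset.sum_sub_distrib, norm_smul, Real.norm_ofNat]
  refine (mul_le_mul_of_nonneg_left h zero_le_two).trans_eq ?_
  simp
  ring

end Penalty

/-! ### Subgradients from quadratic minorants -/

theorem indic_of_mem {X : Type*} {C : Set X} {x : X} (hx : x ∈ C) : indic C x = 0 := if_pos hx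

theorem indic_of_notMem {X : Type*} {C : Set X} {x : X} (hx : x ∉ C) : indic C x = ⊤ := if_neg hx

theorem objective_of_mem {E : Type*} [NormedAddCommGroup E] {m : ℕ} {ψ : ℝ → ℝ}
    {D : Fin m → Set E} {C : Set E} {x : E} (hx : x ∈ C) :
    objective ψ D C x = (Psi ψ D x : EReal) := by
  rw [objective, indic_of_mem hx, add_zero]

section Subgradient

variable {E : Type*} [NormedAddCommGroup E] [InnerProductSpace ℝ E]

/-- The slope of a local quadratic minorant is a regular subgradient. -/
theorem mem_regSubdiff_of_quadratic_minorant {f : E → EReal} {x v : E} {r K : ℝ} (hfx : f x = r)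
    (h : ∀ᶠ w in 𝓝 x, ((r + ⟪v, w - x⟫ - K * ‖w - x‖ ^ 2 : ℝ) : EReal) ≤ f w) :
    v ∈ regSubdiff f x := by
  refine ⟨by rw [hfx]; exact EReal.coe_lt_top r, le_of_forall_lt_imp_le_of_dense fun a ha => ?_⟩
  have hlim : Tendsto (fun w : E => ((-K * ‖w - x‖ : ℝ) : EReal)) (𝓝[≠] x) (𝓝 0) := by
    have h1 : Continuous fun w : E => ((-K * ‖w - x‖ : ℝ) : EReal) :=
      continuous_coe_real_ereal.comp (by fun_prop)
    have h2 := h1.tendsto x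
    simp only [sub_self, norm_zero, mul_zero, EReal.coe_zero] at h2
    exact h2.mono_left nhdsWithin_le_nhds
  refine le_liminf_of_le (by isBoundedDefault) ?_
  filter_upwards [hlim.eventually_const_lt ha, nhdsWithin_le_nhds h, self_mem_nhdsWithin]
    with w hw1 hw2 hw3
  refine hw1.le.trans ?_
  have hpos : 0 < ‖w - x‖ := norm_pos_iff.2 (sub_ne_zero.2 hw3)
  rw [EReal.le_div_iff_mul_le (by exact_mod_cast hpos) (EReal.coe_ne_top _), ← EReal.coe_mul, hfx]
  generalize f w = y at hw2
  induction y with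
  | bot => exact absurd hw2 (not_le.2 (EReal.bot_lt_coe _))
  | top => simp
  | coe y =>
    norm_cast at hw2 ⊢
    nlinarith

theorem regSubdiff_subset_subdiff {f : E → EReal} {x : E} : regSubdiff f x ⊆ subdiff f x :=
  fun v hv => ⟨hv.1, fun _ => x, fun _ => v, tendsto_const_nhds, tendsto_const_nhds,
    fun _ => hv, tendsto_const_nhds⟩

/-- Proximal normals of `C` are regular normals. -/
theorem mem_regSubdiff_indic {C : Set E} {u v : E} {K : ℝ} (hu : u ∈ C)
    (hv : ∀ w ∈ C, ⟪v, w - u⟫ ≤ K * ‖w - u‖ ^ 2) : v ∈ regSubdiff (indic C) u := by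
  refine mem_regSubdiff_of_quadratic_minorant (r := 0) (K := K) (indic_of_mem hu)
    (Eventually.of_forall fun w => ?_)
  by_cases hw : w ∈ C
  · rw [indic_of_mem hw]
    have := hv w hw
    exact_mod_cast (by linarith : 0 + ⟪v, w - u⟫ - K * ‖w - u‖ ^ 2 ≤ 0)
  · rw [indic_of_notMem hw]
    exact le_top

variable {m : ℕ} {ψ : ℝ → ℝ} {D : Fin m → Set E} {C : Set E}

/-- Adding the gradient of `Ψ` to a proximal normal of `C` gives a regular subgradient of
`Ψ + δ_C`. The lower bound on `Ψ` near `u` is the descent inequality with base point `w`, the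
direction at `w` being compared with the one at `u`. -/
theorem mem_regSubdiff_objective [ProperSpace E] (hψ : IsTheta ψ) (hDne : ∀ i, (D i).Nonempty)
    (hDcl : ∀ i, IsClosed (D i)) (hD : ∀ i, Convex ℝ (D i)) {u v : E} {K : ℝ} {ξ : Fin m → E}
    (hu : u ∈ C) (hξ : ∀ i, ξ i ∈ proj (D i) u)
    (hv : ∀ w ∈ C, ⟪v, w - u⟫ ≤ K * ‖w - u‖ ^ 2) :
    v + direction ψ D u ξ ∈ regSubdiff (objective ψ D C) u := by
  -- This bounds the distances to all `D i` on the unit ball around `u`.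
  obtain ⟨L, hL0, hL⟩ := exists_lipschitz_direction hψ hD
    (∑ i, Metric.infDist u (D i) + 1)
  have hB : ∀ i, Metric.infDist u (D i) ≤ ∑ i, Metric.infDist u (D i) := fun i =>
    Finset.single_le_sum (f := fun i => Metric.infDist u (D i))
      (fun _ _ => Metric.infDist_nonneg) (Finset.mem_univ i)
  refine mem_regSubdiff_of_quadratic_minorant (r := Psi ψ D u)
    (K := K + L + m * rightDeriv ψ 0) (objective_of_mem hu) ?_
  filter_upwards [Metric.ball_mem_nhds u one_pos] with w hw
  by_cases hwC : w ∈ C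
  · rw [objective_of_mem hwC, EReal.coe_le_coe_iff]
    choose ζ hζ using fun i => proj_nonempty (hDcl i) (hDne i) w
    have h1 := Psi_le_quadratic hψ hζ u
    have h2 := hL u w ξ ζ (fun i => (hB i).trans (by linarith))
      (fun i => Metric.infDist_le_infDist_add_dist.trans
        (add_le_add (hB i) (Metric.mem_ball.1 hw).le)) hξ hζ
    have h3 := real_inner_le_norm (direction ψ D u ξ - direction ψ D w ζ) (w - u)
    have h4 := mul_le_mul_of_nonneg_right h2 (norm_nonneg (w - u))
    have h5 := hv w hwC
    rw [norm_sub_rev u w] at h1 h4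
    rw [← neg_sub w u, inner_neg_right] at h1
    rw [inner_sub_left] at h3
    rw [inner_add_left]
    nlinarith
  · rw [objective, indic_of_notMem hwC, EReal.coe_add_top]
    exact le_top

/-- A step of the algorithm produces a proximal normal of `C` at the new point. -/
theorem IsStep.inner_le {g x u : E} {α : ℝ} (h : IsStep C g x α u) {w : E} (hw : w ∈ C) :
    ⟪-g - (1 / α) • (u - x), w - u⟫ ≤ 1 / (2 * α) * ‖w - u‖ ^ 2 := by
  have h1 : ⟪g, u - x⟫ + 1 / (2 * α) * ‖u - x‖ ^ 2 ≤
    ⟪g, w - x⟫ + 1 / (2 * α) * ‖w - x‖ ^ 2 := h.2 hw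
  have e : w - x = (w - u) + (u - x) := by abel
  have e' : 1 / α = 2 * (1 / (2 * α)) := by
    rw [one_div, one_div, mul_inv]
    ring
  rw [e, norm_add_sq_real, inner_add_right] at h1
  rw [inner_sub_left, inner_neg_left, real_inner_smul_left, e', real_inner_comm (w - u) (u - x)]
  linarith

end Subgradient

/-! ### Boundedness from horizon cones -/

/-- A norm-divergent sequence in `C` with bounded distances to all `D i` and its projections would,
after normalization, cluster at a common unit horizon direction. -/
theorem isBounded_of_horizonCone {E : Type*} [NormedAddCommGroup E] [InnerProductSpace ℝ E]
    [ProperSpace E] {m : ℕ} {C : Set E} {D : Fin m → Set E} (hDne : ∀ i, (D i).Nonempty)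
    (hhor : horizonCone C ∩ ⋂ i, horizonCone (D i) = {0}) (B : ℝ) :
    Bornology.IsBounded {x ∈ C | ∀ i, Metric.infDist x (D i) ≤ B} := by
  by_contra hnb
  rw [isBounded_iff_forall_norm_le] at hnb
  push Not at hnb
  choose x hx hxn using fun n : ℕ => hnb n
  have hpos : ∀ n, 0 < ‖x n‖ := fun n => (Nat.cast_nonneg n).trans_lt (hxn n)
  have hlam : Tendsto (fun n => ‖x n‖⁻¹) atTop (𝓝 0) :=
    (tendsto_atTop_mono (fun n => (hxn n).le) tendsto_natCast_atTop_atTop).inv_tendsto_atTop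
  obtain ⟨d, hd, s, hs, hlim⟩ := (isCompact_sphere (0 : E) 1).tendsto_subseq
    (x := fun n => ‖x n‖⁻¹ • x n) fun n => by
      simp [norm_smul, inv_mul_cancel₀ (hpos n).ne']
  have hlam' : Tendsto (fun n => ‖x (s n)‖⁻¹) atTop (𝓝 0) := hlam.comp hs.tendsto_atTop
  have hdC : d ∈ horizonCone C :=
    ⟨x ∘ s, fun n => ‖x (s n)‖⁻¹, fun n => (hx _).1, fun n => inv_pos.2 (hpos _), hlam', hlim⟩
  have hdD : d ∈ ⋂ i, horizonCone (D i) := by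
    refine mem_iInter.2 fun i => ?_
    have hex : ∀ n, ∃ y ∈ D i, dist (x n) y < B + 1 := fun n =>
      (Metric.infDist_lt_iff (hDne i)).1 (by linarith [(hx n).2 i])
    choose y hyD hy using hex
    refine ⟨y ∘ s, fun n => ‖x (s n)‖⁻¹, fun n => hyD _, fun n => inv_pos.2 (hpos _), hlam', ?_⟩
    have h0 : Tendsto (fun n => ‖x (s n)‖⁻¹ • (x (s n) - y (s n))) atTop (𝓝 0) := by
      refine squeeze_zero_norm (a := fun n => ‖x (s n)‖⁻¹ * (B + 1)) (fun n => ?_)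
        (by simpa using hlam'.mul_const (B + 1))
      rw [norm_smul, norm_inv, norm_norm, ← dist_eq_norm]
      exact mul_le_mul_of_nonneg_left (hy _).le (inv_nonneg.2 (norm_nonneg _))
    have h1 := hlim.sub h0
    rw [sub_zero] at h1
    refine h1.congr fun n => ?_
    simp only [Function.comp, smul_sub, sub_sub_cancel]
  have hd0 : d = 0 := by
    have : d ∈ ({0} : Set E) := hhor ▸ ⟨hdC, hdD⟩
    exact this
  rw [hd0] at hd
  simp at hd

/-! ### Convergence of descent sequences under the Kurdyka-Łojasiewicz inequality -/

section Descent

variable {X : Type*} [PseudoMetricSpace X] {x : ℕ → X} {F : ℕ → ℝ} {a : ℝ}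

theorem tendsto_dist_of_sufficient_decrease (ha : 0 < a)
    (hdec : ∀ t, F (t + 1) + a * dist (x t) (x (t + 1)) ^ 2 ≤ F t) {l : ℝ}
    (hF : Tendsto F atTop (𝓝 l)) : Tendsto (fun t => dist (x t) (x (t + 1))) atTop (𝓝 0) := by
  have h1 : Tendsto (fun t => (F t - F (t + 1)) / a) atTop (𝓝 0) := by
    simpa using (hF.sub (hF.comp (tendsto_add_atTop_nat 1))).div_const a
  have h2 : Tendsto (fun t => dist (x t) (x (t + 1)) ^ 2) atTop (𝓝 0) := by
    refine squeeze_zero (fun t => sq_nonneg _) (fun t => ?_) h1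
    rw [le_div_iff₀ ha]
    linarith [hdec t]
  simpa [Real.sqrt_sq dist_nonneg] using h2.sqrt

/-- One step of the Kurdyka-Łojasiewicz argument: the length of a step is controlled by half the
previous one and the decrease of the desingularized values. -/
theorem two_mul_le_of_desing {ν : EReal} {φ : ℝ → ℝ} (hφ : IsDesing ν φ) {b p q F₁ F₂ : ℝ}
    (ha : 0 < a) (hb : 0 ≤ b) (hp : 0 ≤ p) (hF₁ : (F₁ : EReal) < ν) (hF₂ : 0 ≤ F₂)
    (hdec : F₂ + a * q ^ 2 ≤ F₁) (hKL : 0 < F₁ → 1 ≤ deriv φ F₁ * (b * p)) :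
    2 * q + b / a * φ F₂ ≤ p + b / a * φ F₁ := by
  have haq : 0 ≤ a * q ^ 2 := by positivity
  have h21 : F₂ ≤ F₁ := by linarith
  rcases (hF₂.trans h21).eq_or_lt with h0 | hpos
  · -- If the value has already reached its limit, the step vanishes.
    have hF : F₂ = F₁ := by linarith
    have hq2 : q ^ 2 = 0 := by
      have : a * q ^ 2 ≤ 0 := by linarith
      nlinarith [sq_nonneg q]
    rw [hF, pow_eq_zero_iff two_ne_zero |>.1 hq2]
    linarith
  · have hopen : {s : ℝ | 0 < s ∧ (s : EReal) < ν} ∈ 𝓝 F₁ :=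
      ((isOpen_lt continuous_const continuous_id).inter
        (isOpen_lt continuous_coe_real_ereal continuous_const)).mem_nhds ⟨hpos, hF₁⟩
    have hder := (hφ.differentiableOn.differentiableAt hopen).hasDerivAt
    have hpos' := hφ.deriv_pos F₁ hpos hF₁
    have hF₂ν : (F₂ : EReal) < ν := lt_of_le_of_lt (by exact_mod_cast h21) hF₁
    have hslope : deriv φ F₁ * (F₁ - F₂) ≤ φ F₁ - φ F₂ := by
      rcases h21.eq_or_lt with h | h
      · rw [h]; simp
      · have := hφ.concaveOn.le_slope_of_hasDerivAt (x := F₂) (y := F₁) ⟨hF₂, hF₂ν⟩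
          ⟨hpos.le, hF₁⟩ h hder
        rwa [slope_def_field, le_div_iff₀ (sub_pos.2 h)] at this
    have hA : F₁ - F₂ ≤ b * p * (φ F₁ - φ F₂) := by
      have h1 := mul_le_mul_of_nonneg_left hslope (mul_nonneg hb hp)
      have h2 := mul_le_mul_of_nonneg_right (hKL hpos) (sub_nonneg.2 h21)
      linarith
    have hdiff : 0 ≤ φ F₁ - φ F₂ :=
      (mul_nonneg hpos'.le (sub_nonneg.2 h21)).trans hslope
    have hsq : q ^ 2 ≤ p * (b / a * (φ F₁ - φ F₂)) := by
      have : a * q ^ 2 ≤ b * p * (φ F₁ - φ F₂) := by linarith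
      rw [show p * (b / a * (φ F₁ - φ F₂)) = b * p * (φ F₁ - φ F₂) / a by ring, le_div_iff₀ ha]
      linarith
    have hr : 0 ≤ b / a * (φ F₁ - φ F₂) := by positivity
    have : 2 * q ≤ p + b / a * (φ F₁ - φ F₂) := by
      refine le_of_sq_le_sq ?_ (by linarith)
      nlinarith [sq_nonneg (p - b / a * (φ F₁ - φ F₂))]
    linarith

/-- A sequence with sufficient decrease satisfying a Kurdyka-Łojasiewicz inequality near a cluster
point converges to it. The potential `dist (x (t+1)) x̄ + dist (x t) (x (t+1)) + (b/a) φ (F (t+1))`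
does not increase while the sequence is near `x̄`, and is small infinitely often. -/
theorem tendsto_of_desing {ν : EReal} {φ : ℝ → ℝ} (hν : 0 < ν) (hφ : IsDesing ν φ) {b r : ℝ}
    (ha : 0 < a) (hb : 0 ≤ b) (hr : 0 < r) (hF0 : ∀ t, 0 ≤ F t) (hF : Tendsto F atTop (𝓝 0))
    (hdec : ∀ t, F (t + 1) + a * dist (x t) (x (t + 1)) ^ 2 ≤ F t) {xbar : X} {s : ℕ → ℕ}
    (hs : StrictMono s) (hxs : Tendsto (x ∘ s) atTop (𝓝 xbar))
    (hKL : ∀ t, dist (x (t + 1)) xbar < r → 0 < F (t + 1) → (F (t + 1) : EReal) < ν →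
      1 ≤ deriv φ (F (t + 1)) * (b * dist (x t) (x (t + 1)))) :
    Tendsto x atTop (𝓝 xbar) := by
  have hΔ := tendsto_dist_of_sufficient_decrease ha hdec hF
  have hF1 : Tendsto (fun t => F (t + 1)) atTop (𝓝 0) := hF.comp (tendsto_add_atTop_nat 1)
  have hFν : ∀ᶠ t in atTop, (F (t + 1) : EReal) < ν := by
    have h := (continuous_coe_real_ereal.tendsto 0).comp hF1
    exact h.eventually_lt_const (by simpa using hν)
  have hφF : Tendsto (fun t => φ (F (t + 1))) atTop (𝓝 0) := by
    have h0 : ContinuousWithinAt φ {s : ℝ | 0 ≤ s ∧ (s : EReal) < ν} 0 :=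
      hφ.continuousOn 0 ⟨le_rfl, by simpa using hν⟩
    have h1 := h0.tendsto.comp (tendsto_nhdsWithin_iff.2
      ⟨hF1, hFν.mono fun t ht => ⟨hF0 _, ht⟩⟩)
    rwa [hφ.map_zero] at h1
  set V : ℕ → ℝ := fun t => dist (x (t + 1)) xbar + dist (x t) (x (t + 1)) +
    b / a * φ (F (t + 1)) with hV
  have hVs : Tendsto (V ∘ s) atTop (𝓝 0) := by
    have hΔs := hΔ.comp hs.tendsto_atTop
    have hxs' : Tendsto (fun j => dist (x (s j + 1)) xbar) atTop (𝓝 0) := by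
      refine squeeze_zero (fun _ => dist_nonneg)
        (fun j => dist_triangle_left (x (s j + 1)) xbar (x (s j))) ?_
      simpa using hΔs.add (tendsto_iff_dist_tendsto_zero.1 hxs)
    have h := (hxs'.add hΔs).add ((hφF.comp hs.tendsto_atTop).const_mul (b / a))
    rw [mul_zero, add_zero, add_zero] at h
    exact h
  obtain ⟨T, hT⟩ := eventually_atTop.1 hFν
  have hle : ∀ t ≥ T, dist (x (t + 1)) xbar ≤ V t := fun t ht => by
    have h1 := hφ.nonneg _ (hF0 (t + 1)) (hT t ht)
    have h2 : 0 ≤ b / a * φ (F (t + 1)) := by positivity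
    have h3 : 0 ≤ dist (x t) (x (t + 1)) := dist_nonneg
    simp only [hV]
    linarith
  have hstep : ∀ t ≥ T, V t < r → V (t + 1) ≤ V t := fun t ht hVr => by
    have h1 := two_mul_le_of_desing hφ ha hb dist_nonneg (hT t ht) (hF0 (t + 2))
      (hdec (t + 1)) fun h => hKL t ((hle t ht).trans_lt hVr) h (hT t ht)
    have h2 := dist_triangle_left (x (t + 2)) xbar (x (t + 1))
    simp only [hV]
    linarith
  rw [← tendsto_add_atTop_iff_nat 1, Metric.tendsto_atTop]
  intro ε hε
  obtain ⟨j, hj, hjT⟩ := ((hVs.eventually_lt_const (lt_min hε hr)).and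
    (hs.tendsto_atTop.eventually_ge_atTop T)).exists
  have hsmall : ∀ t ≥ s j, V t < min ε r := fun t ht => by
    induction t, ht using Nat.le_induction with
    | base => exact hj
    | succ t ht ih =>
      exact (hstep t (hjT.trans ht) (ih.trans_le (min_le_right _ _))).trans_lt ih
  exact ⟨s j, fun t ht => (hle t (hjT.trans ht)).trans_lt
    ((hsmall t ht).trans_le (min_le_left _ _))⟩

end Descent

/-! ### The algorithm -/

/-- With memory `0` the linesearch criterion compares with the current value only. -/
theorem accepts_zero_iff {E : Type*} [NormedAddCommGroup E] {m : ℕ} {ψ : ℝ → ℝ}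
    {D : Fin m → Set E} {σ : ℝ} {x : ℕ → E} {t : ℕ} {u : E} :
    Accepts ψ D σ 0 x t u ↔ Psi ψ D u + σ / 2 * ‖u - x t‖ ^ 2 ≤ Psi ψ D (x t) := by
  simp only [Accepts, Nat.sub_zero, Finset.Icc_self, Finset.sup'_singleton]
  constructor <;> intro h <;> linarith

section Run

variable {E : Type*} [NormedAddCommGroup E] [InnerProductSpace ℝ E] {m : ℕ} {ψ : ℝ → ℝ}
  {D : Fin m → Set E} {C : Set E} {αmin αmax η σ : ℝ} {α₀ : ℕ → ℝ} {ξ : ℕ → Fin m → E}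
  {k : ℕ → ℕ} {u : ℕ → ℕ → E} {x : ℕ → E}

theorem IsRun.mem {M : ℕ} (h : IsRun ψ D C M αmin αmax η σ α₀ ξ k u x) : ∀ t, x t ∈ C
  | 0 => h.init
  | t + 1 => by
    rw [h.next t]
    exact (h.trial t _ le_rfl).1

theorem IsRun.stepsize_pos {M : ℕ} (h : IsRun ψ D C M αmin αmax η σ α₀ ξ k u x) (t j : ℕ) :
    0 < η ^ j * α₀ t :=
  mul_pos (pow_pos h.η_mem.1 _) (h.αmin_pos.trans_le (h.α₀_mem t).1)

/-- A trial point with a small stepsize is accepted. -/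
theorem IsRun.accepts_of_le (hψ : IsTheta ψ) (h : IsRun ψ D C 0 αmin αmax η σ α₀ ξ k u x)
    {t j : ℕ} (hj : j ≤ k t)
    (hα : 2 * (m * rightDeriv ψ 0) + σ ≤ 1 / (η ^ j * α₀ t)) : Accepts ψ D σ 0 x t (u t j) := by
  rw [accepts_zero_iff]
  have h1 := Psi_le_quadratic hψ (h.ξ_mem t) (u t j)
  have h2 := (h.trial t j hj).2 (h.mem t)
  simp only [mem_ofPred_eq, sub_self, inner_zero_right, norm_zero] at h2
  have h3 : 1 / (2 * (η ^ j * α₀ t)) = 1 / (η ^ j * α₀ t) / 2 := by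
    rw [one_div, one_div, mul_inv]
    ring
  rw [h3] at h2
  have h4 := mul_le_mul_of_nonneg_right hα (sq_nonneg ‖u t j - x t‖)
  linarith

/-- The accepted stepsizes are bounded away from zero. -/
theorem IsRun.inv_stepsize_le (hψ : IsTheta ψ) (h : IsRun ψ D C 0 αmin αmax η σ α₀ ξ k u x)
    (t : ℕ) : 1 / (η ^ k t * α₀ t) ≤ 1 / αmin + (2 * (m * rightDeriv ψ 0) + σ) / η := by
  have hp := hψ.rightDeriv_nonneg le_rfl
  have hη := h.η_mem.1
  have hσ := h.σ_pos
  have hα := h.αmin_pos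
  rcases hk : k t with _ | j
  · have h1 := one_div_le_one_div_of_le hα (h.α₀_mem t).1
    have h2 : 0 ≤ (2 * (m * rightDeriv ψ 0) + σ) / η := by positivity
    rw [pow_zero, one_mul]
    linarith
  · -- The preceding trial was rejected, so its stepsize was not small.
    have hj : j < k t := by omega
    have h1 : 1 / (η ^ j * α₀ t) < 2 * (m * rightDeriv ψ 0) + σ :=
      not_le.1 fun hle => h.rejected t j hj (h.accepts_of_le hψ hj.le hle)
    have h2 : 1 / (η ^ (j + 1) * α₀ t) = 1 / (η ^ j * α₀ t) / η := by
      rw [pow_succ, div_div]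
      ring_nf
    have h3 := div_le_div_of_nonneg_right h1.le hη.le
    have h4 : 0 ≤ 1 / αmin := by positivity
    rw [h2]
    linarith

theorem IsRun.sufficient_decrease (h : IsRun ψ D C 0 αmin αmax η σ α₀ ξ k u x) (t : ℕ) :
    Psi ψ D (x (t + 1)) + σ / 2 * dist (x t) (x (t + 1)) ^ 2 ≤ Psi ψ D (x t) := by
  rw [dist_comm, dist_eq_norm, h.next t]
  exact accepts_zero_iff.1 (h.accepted t)

theorem IsRun.antitone_Psi (h : IsRun ψ D C 0 αmin αmax η σ α₀ ξ k u x) :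
    Antitone fun t => Psi ψ D (x t) :=
  antitone_nat_of_succ_le fun t => by
    have h1 := h.sufficient_decrease t
    have h2 := h.σ_pos
    have h3 : 0 ≤ σ / 2 * dist (x t) (x (t + 1)) ^ 2 := by positivity
    linarith

/-- Level-boundedness of `ψ` bounds the distances of the iterates to the sets. -/
theorem IsRun.exists_infDist_le (hψ : IsTheta ψ)
    (h : IsRun ψ D C 0 αmin αmax η σ α₀ ξ k u x) :
    ∃ B, ∀ t i, Metric.infDist (x t) (D i) ≤ B := by
  obtain ⟨R, hR⟩ := isBounded_iff_forall_norm_le.1 (hψ.levelBounded (Psi ψ D (x 0)))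
  refine ⟨R + 1, fun t i => ?_⟩
  have h1 : ψ (Metric.infDist (x t) (D i) ^ 2) ≤ Psi ψ D (x t) :=
    Finset.single_le_sum (f := fun i => ψ (Metric.infDist (x t) (D i) ^ 2))
      (fun _ _ => hψ.nonneg _ (sq_nonneg _)) (Finset.mem_univ i)
  have h2 := hR _ ⟨sq_nonneg _, h1.trans (h.antitone_Psi (Nat.zero_le t))⟩
  rw [Real.norm_of_nonneg (sq_nonneg _)] at h2
  nlinarith [sq_nonneg (Metric.infDist (x t) (D i) - 1)]

/-- The proximal normal of `C` at `x (t + 1)` produced by iteration `t`. -/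
noncomputable def stepNormal (ψ : ℝ → ℝ) (D : Fin m → Set E) (η : ℝ) (α₀ : ℕ → ℝ)
    (ξ : ℕ → Fin m → E) (k : ℕ → ℕ) (x : ℕ → E) (t : ℕ) : E :=
  -direction ψ D (x t) (ξ t) - (1 / (η ^ k t * α₀ t)) • (x (t + 1) - x t)

theorem IsRun.inner_stepNormal_le {M : ℕ} (h : IsRun ψ D C M αmin αmax η σ α₀ ξ k u x) (t : ℕ)
    {w : E} (hw : w ∈ C) :
    ⟪stepNormal ψ D η α₀ ξ k x t, w - x (t + 1)⟫ ≤
      1 / (2 * (η ^ k t * α₀ t)) * ‖w - x (t + 1)‖ ^ 2 := by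
  rw [stepNormal, h.next t]
  exact (h.trial t _ le_rfl).inner_le hw

/-- The distance of the step normal from the negative gradient at a point `y`. With
`y = x (t + 1)` this bounds a subgradient of `Ψ + δ_C` by the step length; with `y` the limit of the
iterates it gives stationarity. -/
theorem IsRun.norm_stepNormal_add_le (hψ : IsTheta ψ)
    (h : IsRun ψ D C 0 αmin αmax η σ α₀ ξ k u x) {L : ℝ} {t : ℕ} {y : E} {ζ : Fin m → E}
    (hL : ‖direction ψ D y ζ - direction ψ D (x t) (ξ t)‖ ≤ L * ‖y - x t‖) :
    ‖stepNormal ψ D η α₀ ξ k x t + direction ψ D y ζ‖ ≤ L * dist (x t) y +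
      (1 / αmin + (2 * (m * rightDeriv ψ 0) + σ) / η) * dist (x t) (x (t + 1)) := by
  have e : stepNormal ψ D η α₀ ξ k x t + direction ψ D y ζ =
      (direction ψ D y ζ - direction ψ D (x t) (ξ t)) -
        (1 / (η ^ k t * α₀ t)) • (x (t + 1) - x t) := by
    rw [stepNormal]
    abel
  rw [e, dist_comm, dist_comm (x t), dist_eq_norm, dist_eq_norm]
  refine (norm_sub_le _ _).trans (add_le_add hL ?_)
  rw [norm_smul, Real.norm_of_nonneg (one_div_pos.2 (h.stepsize_pos t _)).le]
  exact mul_le_mul_of_nonneg_right (h.inv_stepsize_le hψ t) (norm_nonneg _)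

/-- A limit of the iterates is stationary: the step normals converge to the negative gradient. -/
theorem IsRun.isStationary_of_tendsto [ProperSpace E] (hψ : IsTheta ψ) (hCcl : IsClosed C)
    (hDne : ∀ i, (D i).Nonempty) (hDcl : ∀ i, IsClosed (D i)) (hD : ∀ i, Convex ℝ (D i))
    (h : IsRun ψ D C 0 αmin αmax η σ α₀ ξ k u x) {xbar : E} (hx : Tendsto x atTop (𝓝 xbar)) :
    IsStationary ψ D C xbar := by
  have hxC : xbar ∈ C := hCcl.mem_of_tendsto hx (Eventually.of_forall h.mem)
  have hx1 : Tendsto (fun t => x (t + 1)) atTop (𝓝 xbar) := hx.comp (tendsto_add_atTop_nat 1)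
  obtain ⟨B, hB⟩ := h.exists_infDist_le hψ
  have hBx : ∀ i, Metric.infDist xbar (D i) ≤ B := fun i =>
    le_of_tendsto (((Metric.continuous_infDist_pt (D i)).tendsto xbar).comp hx)
      (Eventually.of_forall fun t => hB t i)
  obtain ⟨L, -, hL⟩ := exists_lipschitz_direction hψ hD B
  choose ζ hζ using fun i => proj_nonempty (hDcl i) (hDne i) xbar
  refine ⟨ζ, hζ, -direction ψ D xbar ζ, ⟨by simp [indic_of_mem hxC], fun t => x (t + 1),
    stepNormal ψ D η α₀ ξ k x, hx1, ?_, fun t => mem_regSubdiff_indic (h.mem _)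
      fun w hw => h.inner_stepNormal_le t hw, ?_⟩, add_neg_cancel _⟩
  · simp only [indic_of_mem hxC, indic_of_mem (h.mem _)]
    exact tendsto_const_nhds
  · have hv : Tendsto (fun t => stepNormal ψ D η α₀ ξ k x t + direction ψ D xbar ζ) atTop
        (𝓝 0) := by
      refine squeeze_zero_norm (fun t => h.norm_stepNormal_add_le hψ
        (hL xbar (x t) ζ (ξ t) hBx (hB t) hζ (h.ξ_mem t))) ?_
      simpa using ((hx.dist (tendsto_const_nhds (x := xbar))).const_mul L).add
        ((hx.dist hx1).const_mul (1 / αmin + (2 * (m * rightDeriv ψ 0) + σ) / η))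
    simpa using hv.sub_const (direction ψ D xbar ζ)

/-- The iterates converge. A cluster point exists by the horizon condition; the subgradients
`stepNormal + ∇Ψ` at `x (t + 1)`, of norm at most a multiple of the step length, put `0` into the
subdifferential there, and turn the Kurdyka-Łojasiewicz property into the inequality that
`tendsto_of_desing` needs. -/
theorem IsRun.exists_tendsto [ProperSpace E] (hψ : IsTheta ψ) (hCcl : IsClosed C)
    (hDne : ∀ i, (D i).Nonempty) (hDcl : ∀ i, IsClosed (D i)) (hD : ∀ i, Convex ℝ (D i))
    (hhor : horizonCone C ∩ ⋂ i, horizonCone (D i) = {0})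
    (hKL : ∀ y, (subdiff (objective ψ D C) y).Nonempty → KLAt (objective ψ D C) y)
    (h : IsRun ψ D C 0 αmin αmax η σ α₀ ξ k u x) : ∃ xbar, Tendsto x atTop (𝓝 xbar) := by
  obtain ⟨B, hB⟩ := h.exists_infDist_le hψ
  obtain ⟨L, hL0, hL⟩ := exists_lipschitz_direction hψ hD B
  obtain ⟨xbar, -, s, hs, hxs⟩ := tendsto_subseq_of_bounded
    (isBounded_of_horizonCone hDne hhor B) fun t => ⟨h.mem t, hB t⟩
  have hxC : xbar ∈ C := hCcl.mem_of_tendsto hxs (Eventually.of_forall fun _ => h.mem _)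
  have hP : Tendsto (fun t => Psi ψ D (x t)) atTop (𝓝 (Psi ψ D xbar)) := by
    have h1 := tendsto_atTop_ciInf h.antitone_Psi ⟨0, by rintro _ ⟨t, rfl⟩; exact Psi_nonneg hψ _⟩
    have h2 := ((continuous_Psi (D := D) hψ).tendsto xbar).comp hxs
    rwa [tendsto_nhds_unique (h1.comp hs.tendsto_atTop) h2] at h1
  have hσ : 0 < σ / 2 := half_pos h.σ_pos
  have hΔ := tendsto_dist_of_sufficient_decrease hσ h.sufficient_decrease hP
  set b : ℝ := L + (1 / αmin + (2 * (m * rightDeriv ψ 0) + σ) / η) with hb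
  have hb0 : 0 ≤ b := by
    have := h.αmin_pos
    have := h.η_mem.1
    have := h.σ_pos
    have := hψ.rightDeriv_nonneg le_rfl
    positivity
  set w : ℕ → E := fun t =>
    stepNormal ψ D η α₀ ξ k x t + direction ψ D (x (t + 1)) (ξ (t + 1)) with hw
  have hwmem : ∀ t, w t ∈ regSubdiff (objective ψ D C) (x (t + 1)) := fun t =>
    mem_regSubdiff_objective hψ hDne hDcl hD (h.mem _) (h.ξ_mem _)
      fun y hy => h.inner_stepNormal_le t hy
  have hwnorm : ∀ t, ‖w t‖ ≤ b * dist (x t) (x (t + 1)) := fun t =>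
    (h.norm_stepNormal_add_le hψ (hL _ _ _ _ (hB _) (hB _) (h.ξ_mem _) (h.ξ_mem _))).trans_eq
      (add_mul _ _ _).symm
  have hw0 : Tendsto w atTop (𝓝 0) := squeeze_zero_norm hwnorm (by simpa using hΔ.const_mul b)
  have hxs1 : Tendsto (fun j => x (s j + 1)) atTop (𝓝 xbar) := by
    refine tendsto_iff_dist_tendsto_zero.2 (squeeze_zero (fun _ => dist_nonneg)
      (fun j => dist_triangle_left (x (s j + 1)) xbar (x (s j))) ?_)
    simpa using (hΔ.comp hs.tendsto_atTop).add (tendsto_iff_dist_tendsto_zero.1 hxs)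
  have hcrit : (0 : E) ∈ subdiff (objective ψ D C) xbar := by
    refine ⟨by rw [objective_of_mem hxC]; exact EReal.coe_lt_top _, fun j => x (s j + 1), w ∘ s,
      hxs1, ?_, fun j => hwmem _, hw0.comp hs.tendsto_atTop⟩
    simp only [objective_of_mem hxC, objective_of_mem (h.mem _)]
    exact (continuous_coe_real_ereal.tendsto _).comp (((continuous_Psi hψ).tendsto xbar).comp hxs1)
  obtain ⟨N, hN, ν, hν, φ, hφ, hineq⟩ := hKL xbar ⟨0, hcrit⟩
  obtain ⟨r, hr, hrN⟩ := Metric.mem_nhds_iff.1 hN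
  refine ⟨xbar, tendsto_of_desing (F := fun t => Psi ψ D (x t) - Psi ψ D xbar) hν hφ hσ hb0 hr
    (fun t => sub_nonneg.2 (h.antitone_Psi.le_of_tendsto hP t)) 
    (by simpa using hP.sub_const (Psi ψ D xbar))
    (fun t => by linarith [h.sufficient_decrease t]) hs hxs fun t hdist hpos hlt => ?_⟩
  have h1 := hineq (x (t + 1)) (hrN hdist)
  rw [objective_of_mem hxC, objective_of_mem (h.mem _), ← EReal.coe_sub, EReal.toReal_coe] at h1
  have h2 := h1 (by exact_mod_cast sub_pos.1 hpos) (by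
    rw [EReal.coe_sub] at hlt
    have := EReal.add_lt_add_left_coe hlt (Psi ψ D xbar)
    rwa [← EReal.coe_sub, ← EReal.coe_add, add_sub_cancel] at this)
  have h3 : Metric.infEDist 0 (subdiff (objective ψ D C) (x (t + 1))) ≤
      ENNReal.ofReal (b * dist (x t) (x (t + 1))) := by
    refine (Metric.infEDist_le_edist_of_mem (regSubdiff_subset_subdiff (hwmem t))).trans ?_
    rw [edist_dist, dist_zero_left]
    exact ENNReal.ofReal_le_ofReal (hwnorm t)
  have h4 := h2.trans (mul_le_mul_right h3 _)
  rwa [← ENNReal.ofReal_mul (hφ.deriv_pos _ hpos hlt).le, ENNReal.one_le_ofReal] at h4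

end Run

end SubgradProj

theorem mainTheorem2 (n m : ℕ)
    (C : Set (EuclideanSpace ℝ (Fin n))) (D : Fin m → Set (EuclideanSpace ℝ (Fin n)))
    (hCne : C.Nonempty) (hCcl : IsClosed C)
    (hDne : ∀ i, (D i).Nonempty) (hDcl : ∀ i, IsClosed (D i)) (hDconv : ∀ i, Convex ℝ (D i))
    (hhor : SubgradProj.horizonCone C ∩ ⋂ i, SubgradProj.horizonCone (D i) = {0})
    (ψ : ℝ → ℝ) (hψ : SubgradProj.IsTheta ψ)
    (hKL : SubgradProj.IsKLFunction (SubgradProj.objective ψ D C))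
    (x : ℕ → EuclideanSpace ℝ (Fin n)) (hx : SubgradProj.IsGenerated ψ D C 0 x) :
    ∃ xbar, Tendsto x atTop (𝓝 xbar) ∧ SubgradProj.IsStationary ψ D C xbar := by
  obtain ⟨αmin, αmax, η, σ, α₀, ξ, k, u, h⟩ := hx
  obtain ⟨xbar, hxbar⟩ := h.exists_tendsto hψ hCcl hDne hDcl hDconv hhor hKL.kl
  exact ⟨xbar, hxbar, h.isStationary_of_tendsto hψ hCcl hDne hDcl hDconv hxbar⟩
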